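/- Let $(\Omega,\mathcal F,\mathbb F=(\mathcal F_t)_{0\le t\le T},\mathbb P)$ be a complete filtered probability space satisfying the usual hypotheses, and let $S=(S_t)_{0\le t\le T}$ be a strictly positive continuous semimartingale. For a predictable $S$-integrable process $H$, let $H\cdot S$ denote its stochastic integral. For $a\ge 0$, call such an $H$ \emph{constrained $a$-admissible} if $H_t\ge 0$ and $(H\cdot S)_t\ge -a$ for all $t\in[0,T]$, and let $\mathcal A_C$ be the set of all $H$ that are constrained $a$-admissible for some $a\ge 0$. (Relations between random variables and processes are understood almost surely.) Let $U:\Omega\times(0,\infty)\to\mathbb R$ be a stochastic utility function: with the extension $U(x)=-\infty$ for $x\le 0$ it is $\mathcal F_T\otimes\mathcal B(\mathbb R)$-measurable, $\mathbb E[|U(x)|]<\infty$ for all $x>0$, and almost surely $x\mapsto U(x)$ is continuously differentiable, strictly increasing and strictly concave on $(0,\infty)$ with $\lim_{x\to\infty}U(x)=\infty$, $\lim_{x\downarrow0}U'(x)=\infty$ and $\lim_{x\to\infty}U'(x)=0$. For $x>0$ put $$u(x)=\sup_{H\in\mathcal A_C}\mathbb E\left[U(x+(H\cdot S)_T)\right],$$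 where the expectation is $-\infty$ by convention whenever the negative part of the integrand has infinite expectation. Assume that for some $x>0$ the value $u(x)$ is finite and is attained by some $\widehat H\in\mathcal A_C$. Then: (i) $\widehat H$ is $C$-maximal: for every $K\in\mathcal A_C$, $(K\cdot S)_T\ge(\widehat H\cdot S)_T$ implies $(K\cdot S)_T=(\widehat H\cdot S)_T$. (ii) $\mathrm{NFLVR}_C$ holds, that is, both of the following hold: $(\mathrm{NA}_C)$ for every $H\in\mathcal A_C$, $(H\cdot S)_T\ge 0$ implies $(H\cdot S)_T=0$; and $(\mathrm{NUPBR}_C)$ the set $\{1+(H\cdot S)_T : H \text{ is constrained } 1\text{-admissible}\}$ is bounded in $\mathbb L^0$ (bounded in probability). -/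

import Mathlib

open MeasureTheory ProbabilityTheory Filter Topology
open scoped NNReal ENNReal

namespace ConstrainedMarket

noncomputable section

/-! ### The time interval `[0, T]` and processes -/

/-- The time interval `[0, T]`; its least element `⊥` is `0` and its greatest element `⊤` is `T`. -/
abbrev TimeInterval (T : ℝ≥0) : Type := Set.Iic T

instance instCompactIccTimeInterval (T : ℝ≥0) : CompactIccSpace (TimeInterval T) where
  isCompact_Icc {a b} := by
    rw [Subtype.isCompact_iff, Set.image_subtype_val_Icc]
    exact isCompact_Icc

/-- A real-valued process indexed by `[0, T]`. -/
abbrev RealProcess (T : ℝ≥0) (Ω : Type*) : Type _ := TimeInterval T → Ω → ℝ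

variable {Ω : Type*} [mΩ : MeasurableSpace Ω] {T : ℝ≥0}

/-- The usual hypotheses: the filtration is right-continuous and its initial σ-algebra contains all
the subsets of null sets (in particular the probability space is complete). -/
structure UsualHypotheses (P : Measure Ω) (F : Filtration (TimeInterval T) mΩ) : Prop where
  rightContinuous : F.IsRightContinuous
  complete : ∀ s : Set Ω, P s = 0 → MeasurableSet[F ⊥] s

/-- Adapted processes with (almost surely) continuous paths. -/
def IsContinuousAdapted (P : Measure Ω) (F : Filtration (TimeInterval T) mΩ)
    (X : RealProcess T Ω) : Prop :=
  StronglyAdapted F X ∧ ∀ᵐ ω ∂P, Continuous fun t => X t ω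

/-- Local martingales. On `[0, T]` a localizing sequence `τ n` is eventually equal to `⊤`, i.e.
eventually does not stop the process at all, almost surely. -/
def IsLocalMartingale (P : Measure Ω) (F : Filtration (TimeInterval T) mΩ)
    (X : RealProcess T Ω) : Prop :=
  Locally (fun Y => Martingale Y F P) F X P

/-- Continuous local martingales null at time `0`. -/
structure IsContinuousLocalMartingaleZero (P : Measure Ω) (F : Filtration (TimeInterval T) mΩ)
    (M : RealProcess T Ω) : Prop where
  continuousAdapted : IsContinuousAdapted P F M
  localMartingale : IsLocalMartingale P F M
  zero : ∀ᵐ ω ∂P, M ⊥ ω = 0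

/-- Continuous adapted processes of finite variation on `[0, T]`, null at time `0`. -/
structure IsContinuousFiniteVariationZero (P : Measure Ω) (F : Filtration (TimeInterval T) mΩ)
    (A : RealProcess T Ω) : Prop where
  continuousAdapted : IsContinuousAdapted P F A
  finiteVariation : ∀ᵐ ω ∂P, BoundedVariationOn (fun t => A t ω) Set.univ
  zero : ∀ᵐ ω ∂P, A ⊥ ω = 0

/-- `S = S₀ + M + A` with `M` a continuous local martingale, `A` a continuous adapted process of
finite variation, both null at `0`. -/
structure IsDecomposition (P : Measure Ω) (F : Filtration (TimeInterval T) mΩ)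
    (S M A : RealProcess T Ω) : Prop where
  localMartingale : IsContinuousLocalMartingaleZero P F M
  finiteVariation : IsContinuousFiniteVariationZero P F A
  eq : ∀ᵐ ω ∂P, ∀ t, S t ω = S ⊥ ω + M t ω + A t ω

/-- Continuous semimartingales. -/
def IsContinuousSemimartingale (P : Measure Ω) (F : Filtration (TimeInterval T) mΩ)
    (S : RealProcess T Ω) : Prop :=
  IsContinuousAdapted P F S ∧ ∃ M A, IsDecomposition P F S M A

/-- `B` is (a version of) the covariation `⟨M, N⟩` of two continuous local martingales null at `0`:
the continuous adapted process of finite variation null at `0` for which `M N - B` is a local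
martingale. It is unique up to indistinguishability. -/
def IsCovariation (P : Measure Ω) (F : Filtration (TimeInterval T) mΩ)
    (M N B : RealProcess T Ω) : Prop :=
  IsContinuousFiniteVariationZero P F B ∧
    IsLocalMartingale P F (fun t ω => M t ω * N t ω - B t ω)

/-! ### Stochastic integration with respect to a continuous semimartingale -/

/-- `∫₀ᵀ |h| |da| < ∞`, where `a` is a path of bounded variation and `|da|` is the total variation
of the Lebesgue–Stieltjes measure of `a`. -/
def PathIntegrable (h a : TimeInterval T → ℝ) : Prop :=
  ∃ ha : BoundedVariationOn a Set.univ, ha.vectorMeasure.Integrable h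

open scoped Classical in
/-- The Lebesgue–Stieltjes integral `∫_{(0,t]} h da` (used only when `PathIntegrable h a`). -/
def pathIntegral (h a : TimeInterval T → ℝ) (t : TimeInterval T) : ℝ :=
  if ha : BoundedVariationOn a Set.univ then
    ∫ᵛ s in Set.Ioc ⊥ t, h s ∂•ha.vectorMeasure
  else 0

/-- `H` is integrable with respect to `S = S₀ + M + A`:
`∫₀ᵀ H² d⟨M⟩ + ∫₀ᵀ |H| |dA| < ∞` almost surely. -/
def IsIntegrand (P : Measure Ω) (F : Filtration (TimeInterval T) mΩ)
    (M A H : RealProcess T Ω) : Prop :=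
  (∀ B, IsCovariation P F M M B →
    ∀ᵐ ω ∂P, PathIntegrable (fun t => H t ω ^ 2) (fun t => B t ω)) ∧
  ∀ᵐ ω ∂P, PathIntegrable (fun t => H t ω) (fun t => A t ω)

/-- `Y` is (a version of) the Itô integral `H • M`: the continuous local martingale null at `0` such
that `⟨Y, N⟩ = ∫ H d⟨M, N⟩` for every continuous local martingale `N` null at `0`.
It is unique up to indistinguishability. -/
structure IsItoIntegral (P : Measure Ω) (F : Filtration (TimeInterval T) mΩ)
    (M H Y : RealProcess T Ω) : Prop where
  localMartingale : IsContinuousLocalMartingaleZero P F Y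
  covariation : ∀ N B, IsContinuousLocalMartingaleZero P F N → IsCovariation P F M N B →
    ∃ C, IsCovariation P F Y N C ∧
      ∀ᵐ ω ∂P, PathIntegrable (fun t => H t ω) (fun t => B t ω) ∧
        ∀ t, C t ω = pathIntegral (fun s => H s ω) (fun s => B s ω) t

/-- `H` is a predictable `S`-integrable process and `X` is (a version of) the stochastic integral
process `H • S = H • M + ∫ H dA`, where `S = S₀ + M + A` is the decomposition of the continuous
semimartingale `S`. Both the decomposition and the integral are unique up to
indistinguishability. -/
structure IsStochasticIntegral (P : Measure Ω) (F : Filtration (TimeInterval T) mΩ)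
    (S H X : RealProcess T Ω) : Prop where
  predictable : IsStronglyPredictable F H
  continuousAdapted : IsContinuousAdapted P F X
  integral : ∀ M A, IsDecomposition P F S M A →
    IsIntegrand P F M A H ∧
      ∃ Y, IsItoIntegral P F M H Y ∧
        ∀ᵐ ω ∂P, ∀ t, X t ω = Y t ω + pathIntegral (fun s => H s ω) (fun s => A s ω) t

/-! ### Constrained admissible strategies and no-arbitrage notions -/

/-- `H` is a constrained `a`-admissible trading strategy, i.e. `H ≥ 0` and `H • S ≥ -a`, with gains
process `X = H • S`. -/
structure IsConstrainedAdmissibleWith (P : Measure Ω) (F : Filtration (TimeInterval T) mΩ)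
    (S : RealProcess T Ω) (a : ℝ) (H X : RealProcess T Ω) : Prop where
  integral : IsStochasticIntegral P F S H X
  nonneg : ∀ᵐ ω ∂P, ∀ t, 0 ≤ H t ω
  bound : ∀ᵐ ω ∂P, ∀ t, -a ≤ X t ω

/-- `H` belongs to the set `𝒜_C` of constrained admissible strategies, and `X = H • S`. -/
def IsConstrainedAdmissible (P : Measure Ω) (F : Filtration (TimeInterval T) mΩ)
    (S H X : RealProcess T Ω) : Prop :=
  ∃ a : ℝ, 0 ≤ a ∧ IsConstrainedAdmissibleWith P F S a H X

/-- `H ∈ 𝒜_C` is `C`-maximal: `(K • S)_T ≥ (H • S)_T` implies `(K • S)_T = (H • S)_T` for every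
`K ∈ 𝒜_C`. -/
def IsCMaximal (P : Measure Ω) (F : Filtration (TimeInterval T) mΩ) (S H : RealProcess T Ω) : Prop :=
  (∃ X, IsConstrainedAdmissible P F S H X) ∧
    ∀ X, IsConstrainedAdmissible P F S H X →
      ∀ K Y, IsConstrainedAdmissible P F S K Y → X ⊤ ≤ᵐ[P] Y ⊤ → Y ⊤ =ᵐ[P] X ⊤

/-- No arbitrage for constrained strategies, `NA_C`. -/
def NAC (P : Measure Ω) (F : Filtration (TimeInterval T) mΩ) (S : RealProcess T Ω) : Prop :=
  ∀ H X, IsConstrainedAdmissible P F S H X → 0 ≤ᵐ[P] X ⊤ → X ⊤ =ᵐ[P] 0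

/-- Boundedness of a set of random variables in `L⁰`, i.e. in probability. -/
def IsBoundedInL0 (P : Measure Ω) (K : Set (Ω → ℝ)) : Prop :=
  ∀ ε : ℝ≥0∞, 0 < ε → ∃ c : ℝ, ∀ f ∈ K, P {ω | c < |f ω|} ≤ ε

/-- `𝒦_C`, the set of all `1 + (H • S)_T` with `H` constrained `1`-admissible. -/
def KC (P : Measure Ω) (F : Filtration (TimeInterval T) mΩ) (S : RealProcess T Ω) : Set (Ω → ℝ) :=
  {f | ∃ H X, IsConstrainedAdmissibleWith P F S 1 H X ∧ f = fun ω => 1 + X ⊤ ω}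

/-- No unbounded profit with bounded risk for constrained strategies, `NUPBR_C`. -/
def NUPBRC (P : Measure Ω) (F : Filtration (TimeInterval T) mΩ) (S : RealProcess T Ω) : Prop :=
  IsBoundedInL0 P (KC P F S)

/-- No free lunch with vanishing risk for constrained strategies, `NFLVR_C`. -/
def NFLVRC (P : Measure Ω) (F : Filtration (TimeInterval T) mΩ) (S : RealProcess T Ω) : Prop :=
  NAC P F S ∧ NUPBRC P F S

/-! ### Utility maximization -/

/-- The extension of `U(ω, ·) : (0, ∞) → ℝ` to all of `ℝ` by the value `-∞` on `(-∞, 0]`. -/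
def extendUtility (U : Ω → ℝ → ℝ) (ω : Ω) (y : ℝ) : EReal :=
  if 0 < y then (U ω y : EReal) else ⊥

/-- Stochastic utility functions `U : Ω × (0, ∞) → ℝ`; only the values `U ω y` with `0 < y`
matter. -/
structure IsStochasticUtility (P : Measure Ω) (F : Filtration (TimeInterval T) mΩ)
    (U : Ω → ℝ → ℝ) : Prop where
  measurable : Measurable[(F ⊤).prod (borel ℝ)]
    fun p : Ω × ℝ => extendUtility U p.1 p.2
  integrable : ∀ y : ℝ, 0 < y → Integrable (fun ω => U ω y) P
  contDiff : ∀ᵐ ω ∂P, ContDiffOn ℝ 1 (U ω) (Set.Ioi 0)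
  strictMono : ∀ᵐ ω ∂P, StrictMonoOn (U ω) (Set.Ioi 0)
  strictConcave : ∀ᵐ ω ∂P, StrictConcaveOn ℝ (Set.Ioi 0) (U ω)
  tendsto_atTop : ∀ᵐ ω ∂P, Tendsto (U ω) atTop atTop
  inada_zero : ∀ᵐ ω ∂P, Tendsto (deriv (U ω)) (𝓝[>] 0) atTop
  inada_top : ∀ᵐ ω ∂P, Tendsto (deriv (U ω)) atTop (𝓝 0)

open scoped Classical in
/-- The expectation of an extended real random variable, with the convention that it equals `-∞`
whenever the negative part has infinite expectation. -/
def extendedExpectation (P : Measure Ω) (Z : Ω → EReal) : EReal :=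
  if ∫⁻ ω, (-Z ω).toENNReal ∂P = ∞ then ⊥
  else ((∫⁻ ω, (Z ω).toENNReal ∂P : ℝ≥0∞) : EReal) - ((∫⁻ ω, (-Z ω).toENNReal ∂P : ℝ≥0∞) : EReal)

/-- `E[U(x + X_T)]`, the expected utility of terminal wealth for the gains process `X`. -/
def expectedUtility (P : Measure Ω) (U : Ω → ℝ → ℝ) (x : ℝ) (X : RealProcess T Ω) : EReal :=
  extendedExpectation P fun ω => extendUtility U ω (x + X ⊤ ω)

/-- The value function `u(x) = sup_{H ∈ 𝒜_C} E[U(x + (H • S)_T)]`. -/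
def valueFunction (P : Measure Ω) (F : Filtration (TimeInterval T) mΩ) (S : RealProcess T Ω)
    (U : Ω → ℝ → ℝ) (x : ℝ) : EReal :=
  ⨆ (H : RealProcess T Ω) (X : RealProcess T Ω) (_ : IsConstrainedAdmissible P F S H X),
    expectedUtility P U x X

/-- `H ∈ 𝒜_C` is an optimal solution of the utility maximization problem with initial wealth
`x`. -/
def IsOptimal (P : Measure Ω) (F : Filtration (TimeInterval T) mΩ) (S : RealProcess T Ω)
    (U : Ω → ℝ → ℝ) (x : ℝ) (H : RealProcess T Ω) : Prop :=
  (∃ X, IsConstrainedAdmissible P F S H X) ∧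
    ∀ X, IsConstrainedAdmissible P F S H X →
      expectedUtility P U x X = valueFunction P F S U x

end

end ConstrainedMarket

open ConstrainedMarket

/-!
The terminal wealths `x + (H • S)_T` that stay above a fixed level `y > 0` almost surely form a
family bounded in probability (`exists_measure_lt_wealth_le`). Indeed
`E[U(x + (H • S)_T)] ≤ u(x) < ∞`, while the negative part of `U(x + (H • S)_T)` is at most that of
`U(y)`, which is integrable. So the positive parts are bounded in `L¹`, and Markov's inequality
together with `U(c) → ∞` as `c → ∞` bounds the probabilities `P(x + (H • S)_T > c)` uniformly.

Since the constraint `H ≥ 0` is a cone, constrained admissible strategies can be multiplied by any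
constant `c ≥ 0` (`IsConstrainedAdmissibleWith.const_mul`). This yields both parts of `NFLVR_C`.

* `NUPBR_C`: if `H` is `1`-admissible, then `(x / 2) H` leads to the terminal wealth
  `x / 2 + (x / 2) (1 + (H • S)_T) ≥ x / 2`.
* `NA_C`: if `(H • S)_T ≥ 0`, then the wealths `x + n (H • S)_T ≥ x`, `n ∈ ℕ`, are bounded in
  probability, hence `P((H • S)_T > 0) = 0`.

The `C`-maximality of an optimal strategy is the strict monotonicity of expected utility among
outcomes of finite expectation (`ae_eq_of_extendedExpectation_le`).
-/

namespace ConstrainedMarket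

variable {Ω : Type*} [mΩ : MeasurableSpace Ω] {T : ℝ≥0} {P : Measure Ω}
  {F : Filtration (TimeInterval T) mΩ}

/-! ### Scaling of stochastic integrals and admissible strategies -/

lemma _root_.BoundedVariationOn.const_mul {α : Type*} [LinearOrder α] {f : α → ℝ} {s : Set α}
    (hf : BoundedVariationOn f s) (c : ℝ) : BoundedVariationOn (fun t => c * f t) s :=
  (lipschitzWith_smul c).comp_boundedVariationOn hf

lemma IsContinuousAdapted.const_mul {X : RealProcess T Ω} (hX : IsContinuousAdapted P F X) (c : ℝ) :
    IsContinuousAdapted P F (fun t ω => c * X t ω) := by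
  refine ⟨hX.1.smul c, ?_⟩
  filter_upwards [hX.2] with ω hω using hω.const_mul c

lemma IsLocalMartingale.const_mul {X : RealProcess T Ω} (hX : IsLocalMartingale P F X) (c : ℝ) :
    IsLocalMartingale P F (fun t ω => c * X t ω) := by
  obtain ⟨τ, hτ, hm⟩ := hX
  refine ⟨τ, hτ, fun n => ?_⟩
  convert (hm n).smul c using 1
  ext t ω
  by_cases h : ⊥ < τ n ω <;> simp [stoppedProcess, Set.indicator, h]

lemma IsContinuousLocalMartingaleZero.const_mul {M : RealProcess T Ω}
    (hM : IsContinuousLocalMartingaleZero P F M) (c : ℝ) :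
    IsContinuousLocalMartingaleZero P F (fun t ω => c * M t ω) where
  continuousAdapted := hM.continuousAdapted.const_mul c
  localMartingale := hM.localMartingale.const_mul c
  zero := by filter_upwards [hM.zero] with ω hω; simp [hω]

lemma IsContinuousFiniteVariationZero.const_mul {A : RealProcess T Ω}
    (hA : IsContinuousFiniteVariationZero P F A) (c : ℝ) :
    IsContinuousFiniteVariationZero P F (fun t ω => c * A t ω) where
  continuousAdapted := hA.continuousAdapted.const_mul c
  finiteVariation := by filter_upwards [hA.finiteVariation] with ω hω using hω.const_mul c
  zero := by filter_upwards [hA.zero] with ω hω; simp [hω]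

lemma IsCovariation.const_mul {M N B : RealProcess T Ω} (h : IsCovariation P F M N B) (c : ℝ) :
    IsCovariation P F (fun t ω => c * M t ω) N (fun t ω => c * B t ω) := by
  refine ⟨h.1.const_mul c, ?_⟩
  convert h.2.const_mul c using 3
  ring

lemma PathIntegrable.const_mul {h a : TimeInterval T → ℝ} (hh : PathIntegrable h a) (c : ℝ) :
    PathIntegrable (fun t => c * h t) a := by
  obtain ⟨ha, hi⟩ := hh
  exact ⟨ha, hi.const_mul c⟩

lemma pathIntegral_const_mul (h a : TimeInterval T → ℝ) (c : ℝ) (t : TimeInterval T) :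
    pathIntegral (fun s => c * h s) a t = c * pathIntegral h a t := by
  unfold pathIntegral
  split_ifs with ha
  · exact VectorMeasure.integral_fun_smul _ _ c h
  · simp

lemma IsIntegrand.const_mul {M A H : RealProcess T Ω} (h : IsIntegrand P F M A H) (c : ℝ) :
    IsIntegrand P F M A (fun t ω => c * H t ω) := by
  refine ⟨fun B hB => ?_, ?_⟩
  · filter_upwards [h.1 B hB] with ω hω
    simpa only [mul_pow] using hω.const_mul (c ^ 2)
  · filter_upwards [h.2] with ω hω using hω.const_mul c

lemma IsItoIntegral.const_mul {M H Y : RealProcess T Ω} (h : IsItoIntegral P F M H Y) (c : ℝ) :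
    IsItoIntegral P F M (fun t ω => c * H t ω) (fun t ω => c * Y t ω) where
  localMartingale := h.localMartingale.const_mul c
  covariation N B hN hB := by
    obtain ⟨C, hC, hCB⟩ := h.covariation N B hN hB
    refine ⟨_, hC.const_mul c, ?_⟩
    filter_upwards [hCB] with ω hω
    exact ⟨hω.1.const_mul c, fun t => by rw [pathIntegral_const_mul, hω.2 t]⟩

lemma IsStochasticIntegral.const_mul {S H X : RealProcess T Ω}
    (h : IsStochasticIntegral P F S H X) (c : ℝ) :
    IsStochasticIntegral P F S (fun t ω => c * H t ω) (fun t ω => c * X t ω) where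
  predictable := StronglyMeasurable.const_smul h.predictable c
  continuousAdapted := h.continuousAdapted.const_mul c
  integral M A hMA := by
    obtain ⟨hH, Y, hY, hX⟩ := h.integral M A hMA
    refine ⟨hH.const_mul c, _, hY.const_mul c, ?_⟩
    filter_upwards [hX] with ω hω t
    rw [hω t, pathIntegral_const_mul, mul_add]

lemma IsConstrainedAdmissibleWith.const_mul {S H X : RealProcess T Ω} {a c : ℝ}
    (h : IsConstrainedAdmissibleWith P F S a H X) (hc : 0 ≤ c) :
    IsConstrainedAdmissibleWith P F S (c * a) (fun t ω => c * H t ω) (fun t ω => c * X t ω) where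
  integral := h.integral.const_mul c
  nonneg := by filter_upwards [h.nonneg] with ω hω t using mul_nonneg hc (hω t)
  bound := by
    filter_upwards [h.bound] with ω hω t
    simpa only [mul_neg] using mul_le_mul_of_nonneg_left (hω t) hc

lemma IsConstrainedAdmissible.const_mul {S H X : RealProcess T Ω} {c : ℝ}
    (h : IsConstrainedAdmissible P F S H X) (hc : 0 ≤ c) :
    IsConstrainedAdmissible P F S (fun t ω => c * H t ω) (fun t ω => c * X t ω) := by
  obtain ⟨a, ha, h⟩ := h
  exact ⟨c * a, mul_nonneg hc ha, h.const_mul hc⟩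

lemma IsConstrainedAdmissible.measurable_top {S H X : RealProcess T Ω}
    (h : IsConstrainedAdmissible P F S H X) : Measurable[F ⊤] (X ⊤) := by
  obtain ⟨a, _, h⟩ := h
  exact (h.integral.continuousAdapted.1 ⊤).measurable

/-! ### Extended expectations -/

lemma lintegral_toENNReal_le_of_extendedExpectation_le {Z : Ω → EReal} {v : EReal} {n : ℝ≥0∞}
    (hn : ∫⁻ ω, (-Z ω).toENNReal ∂P ≤ n) (hn_top : n ≠ ∞) (hv : extendedExpectation P Z ≤ v) :
    ∫⁻ ω, (Z ω).toENNReal ∂P ≤ (v + n).toENNReal := by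
  have hfin : ∫⁻ ω, (-Z ω).toENNReal ∂P ≠ ∞ := ne_top_of_le_ne_top hn_top hn
  rw [extendedExpectation, if_neg hfin,
    EReal.sub_le_iff_le_add (.inl (EReal.coe_ennreal_ne_bot _)) (.inl (by simpa using hfin))] at hv
  rw [← EReal.toENNReal_coe (x := ∫⁻ ω, (Z ω).toENNReal ∂P)]
  exact EReal.toENNReal_le_toENNReal
    (hv.trans (add_le_add le_rfl (EReal.coe_ennreal_le_coe_ennreal_iff.2 hn)))

/-- The expectation is strictly monotone at random variables of finite expectation: two ordered
random variables whose expectations are in the opposite order coincide. -/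
lemma ae_eq_of_extendedExpectation_le {Z W : Ω → EReal} (hZ : AEMeasurable Z P)
    (hW : AEMeasurable W P) (hZW : Z ≤ᵐ[P] W)
    (h : extendedExpectation P W ≤ extendedExpectation P Z)
    (h_top : extendedExpectation P Z ≠ ⊤) (h_bot : extendedExpectation P Z ≠ ⊥) :
    Z =ᵐ[P] W := by
  have hneg : (fun ω => (-W ω).toENNReal) ≤ᵐ[P] fun ω => (-Z ω).toENNReal := by
    filter_upwards [hZW] with ω hω using EReal.toENNReal_le_toENNReal (EReal.neg_le_neg_iff.2 hω)
  have hpos : (fun ω => (Z ω).toENNReal) ≤ᵐ[P] fun ω => (W ω).toENNReal := by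
    filter_upwards [hZW] with ω hω using EReal.toENNReal_le_toENNReal hω
  have hneg_le := lintegral_mono_ae hneg
  have hpos_le := lintegral_mono_ae hpos
  have hZn : ∫⁻ ω, (-Z ω).toENNReal ∂P ≠ ∞ := fun h0 => h_bot (by simp [extendedExpectation, h0])
  have hWn := ne_top_of_le_ne_top hZn hneg_le
  have hWp : ∫⁻ ω, (W ω).toENNReal ∂P ≠ ∞ := by
    refine ne_top_of_le_ne_top ?_ (lintegral_toENNReal_le_of_extendedExpectation_le le_rfl hWn h)
    rw [EReal.toENNReal_ne_top_iff]
    exact EReal.add_ne_top h_top (by simpa using hWn)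
  have hZp := ne_top_of_le_ne_top hWp hpos_le
  rw [extendedExpectation, extendedExpectation, if_neg hWn, if_neg hZn] at h
  -- With all four integrals finite, the comparison of expectations is one of real numbers.
  have key : ∫⁻ ω, (W ω).toENNReal ∂P ≤ ∫⁻ ω, (Z ω).toENNReal ∂P ∧
      ∫⁻ ω, (-Z ω).toENNReal ∂P ≤ ∫⁻ ω, (-W ω).toENNReal ∂P := by
    generalize ∫⁻ ω, (W ω).toENNReal ∂P = a at *
    generalize ∫⁻ ω, (Z ω).toENNReal ∂P = b at *
    generalize ∫⁻ ω, (-W ω).toENNReal ∂P = c at *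
    generalize ∫⁻ ω, (-Z ω).toENNReal ∂P = d at *
    lift a to ℝ≥0 using hWp
    lift b to ℝ≥0 using hZp
    lift c to ℝ≥0 using hWn
    lift d to ℝ≥0 using hZn
    simp only [ENNReal.coe_le_coe, ← NNReal.coe_le_coe] at *
    have h' : (a : ℝ) - c ≤ b - d := by
      rw [← EReal.coe_le_coe_iff, EReal.coe_sub, EReal.coe_sub]
      exact h
    constructor <;> linarith
  have e1 := ae_eq_of_ae_le_of_lintegral_le hpos hZp
    (measurable_ereal_toENNReal.comp_aemeasurable hW) key.1
  have e2 := ae_eq_of_ae_le_of_lintegral_le hneg hWn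
    (measurable_ereal_toENNReal.comp_aemeasurable hZ.neg) key.2
  filter_upwards [e1, e2] with ω h1 h2
  rcases le_total 0 (Z ω) with h0 | h0
  · have h3 : 0 ≤ W ω := by
      by_contra! hlt
      rw [EReal.toENNReal_of_nonpos (x := -Z ω) (by simpa using h0), EReal.toENNReal_eq_zero_iff] at h2
      exact hlt.not_ge (by simpa using h2)
    exact (EReal.toENNReal_eq_toENNReal h0 h3).1 h1
  · rw [EReal.toENNReal_of_nonpos h0, eq_comm, EReal.toENNReal_eq_zero_iff] at h1
    exact (neg_inj.1 ((EReal.toENNReal_eq_toENNReal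
      (by simpa using h1) (by simpa using h0)).1 h2)).symm

/-! ### Expected utility of terminal wealth -/

section Utility

variable {S : RealProcess T Ω} {U : Ω → ℝ → ℝ} {x : ℝ}

omit mΩ in
lemma extendUtility_of_pos (U : Ω → ℝ → ℝ) (ω : Ω) {y : ℝ} (hy : 0 < y) :
    extendUtility U ω y = U ω y := if_pos hy

lemma IsStochasticUtility.measurable_comp (hU : IsStochasticUtility P F U) {W : Ω → ℝ}
    (hW : Measurable[F ⊤] W) : Measurable fun ω => extendUtility U ω (W ω) := by
  have h : Measurable[F ⊤] fun ω => extendUtility U ω (W ω) :=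
    hU.measurable.comp (measurable_id.prodMk hW)
  exact h.mono (F.le ⊤) le_rfl

lemma IsStochasticUtility.tendsto_measure_lt (hU : IsStochasticUtility P F U) [IsFiniteMeasure P]
    (m : ℝ) : Tendsto (fun n : ℕ => P {ω | U ω (n + 1) < m}) atTop (𝓝 0) := by
  rw [← measure_empty (μ := P)]
  refine tendsto_measure_of_ae_tendsto_indicator_of_isFiniteMeasure atTop .empty (fun n => ?_) ?_
  · have h : Measurable fun ω => extendUtility U ω ((n : ℝ) + 1) :=
      hU.measurable_comp measurable_const
    have hn : (0 : ℝ) < n + 1 := by positivity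
    simpa only [extendUtility_of_pos U _ hn, EReal.coe_lt_coe_iff] using
      measurableSet_lt h (measurable_const (a := (m : EReal)))
  · filter_upwards [hU.tendsto_atTop] with ω hω
    have h : Tendsto (fun n : ℕ => U ω ((n : ℝ) + 1)) atTop atTop :=
      hω.comp (tendsto_atTop_add_const_right _ _ tendsto_natCast_atTop_atTop)
    filter_upwards [h.eventually_ge_atTop m] with n hn
    simpa using hn

/-- Terminal wealths bounded below by a fixed positive constant are bounded in probability as soon
as the value function is finite. -/
lemma exists_measure_lt_wealth_le [IsFiniteMeasure P] (hU : IsStochasticUtility P F U)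
    (hu : valueFunction P F S U x ≠ ⊤) {y : ℝ} (hy : 0 < y) {ε : ℝ≥0∞} (hε : 0 < ε) :
    ∃ c : ℝ, ∀ H X, IsConstrainedAdmissible P F S H X → (∀ᵐ ω ∂P, y ≤ x + X ⊤ ω) →
      P {ω | c < x + X ⊤ ω} ≤ ε := by
  set n := ∫⁻ ω, ENNReal.ofReal (-U ω y) ∂P with hn_def
  have hn : n ≠ ∞ := ((hU.integrable y hy).neg.lintegral_lt_top).ne
  set C := (valueFunction P F S U x + n).toENNReal with hC_def
  have hC : C ≠ ∞ := by
    rw [hC_def, EReal.toENNReal_ne_top_iff]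
    exact EReal.add_ne_top hu (by simpa using hn)
  have hε2 : 0 < ε / 2 := ENNReal.half_pos hε.ne'
  -- `m` makes the Markov bound `C / m` small, `k` makes `U(k + 1) ≥ m` likely.
  have hm_lim : Tendsto (fun m : ℕ => C / (m : ℝ≥0∞)) atTop (𝓝 0) := by
    simpa using ENNReal.Tendsto.const_div ENNReal.tendsto_nat_nhds_top (Or.inr hC)
  obtain ⟨m, hm, hm0⟩ := ((hm_lim.eventually_le_const hε2).and (eventually_gt_atTop 0)).exists
  obtain ⟨k, hk⟩ := ((hU.tendsto_measure_lt (m : ℝ)).eventually_le_const hε2).exists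
  refine ⟨k + 1, fun H X hX hy_le => ?_⟩
  set Z : Ω → EReal := fun ω => extendUtility U ω (x + X ⊤ ω) with hZ_def
  have hZ_meas : Measurable Z :=
    hU.measurable_comp (hX.measurable_top.const_add x)
  have hZ_neg : ∫⁻ ω, (-Z ω).toENNReal ∂P ≤ n := by
    refine lintegral_mono_ae ?_
    filter_upwards [hy_le, hU.strictMono] with ω hω hmono
    have hpos := hy.trans_le hω
    rw [hZ_def]
    simp only [extendUtility_of_pos U ω hpos, ← EReal.coe_neg, EReal.real_coe_toENNReal]
    exact ENNReal.ofReal_le_ofReal (neg_le_neg (hmono.monotoneOn hy hpos hω))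
  have hZ_le : extendedExpectation P Z ≤ valueFunction P F S U x :=
    le_iSup₂_of_le H X (le_iSup_of_le hX le_rfl)
  have hZ_pos : ∫⁻ ω, (Z ω).toENNReal ∂P ≤ C :=
    lintegral_toENNReal_le_of_extendedExpectation_le hZ_neg hn hZ_le
  have hsub : {ω | (k : ℝ) + 1 < x + X ⊤ ω} ≤ᵐ[P]
      ({ω | U ω (k + 1) < m} ∪ {ω | (m : ℝ≥0∞) ≤ (Z ω).toENNReal} : Set Ω) := by
    filter_upwards [hU.strictMono] with ω hmono (hω : (k : ℝ) + 1 < x + X ⊤ ω)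
    have hk0 : (0 : ℝ) < k + 1 := by positivity
    refine (lt_or_ge (U ω (k + 1)) m).imp id fun h => ?_
    change (m : ℝ≥0∞) ≤ (Z ω).toENNReal
    rw [hZ_def]
    simp only [extendUtility_of_pos U ω (hk0.trans hω), EReal.real_coe_toENNReal]
    rw [← ENNReal.ofReal_natCast]
    exact ENNReal.ofReal_le_ofReal (h.trans (hmono.monotoneOn hk0 (hk0.trans hω) hω.le))
  calc P {ω | (k : ℝ) + 1 < x + X ⊤ ω}
      ≤ P {ω | U ω (k + 1) < m} + P {ω | (m : ℝ≥0∞) ≤ (Z ω).toENNReal} :=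
        (measure_mono_ae hsub).trans (measure_union_le _ _)
    _ ≤ ε / 2 + C / m := by
        refine add_le_add hk ((meas_ge_le_lintegral_div
          (measurable_ereal_toENNReal.comp hZ_meas).aemeasurable (by simpa using hm0.ne')
          (ENNReal.natCast_ne_top m)).trans ?_)
        gcongr
        exact hZ_pos
    _ ≤ ε := (add_le_add le_rfl hm).trans (ENNReal.add_halves ε).le

lemma NUPBRC.of_valueFunction_ne_top [IsFiniteMeasure P] (hU : IsStochasticUtility P F U)
    (hx : 0 < x) (hu : valueFunction P F S U x ≠ ⊤) : NUPBRC P F S := by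
  intro ε hε
  obtain ⟨c, hc⟩ := exists_measure_lt_wealth_le hU hu (half_pos hx) hε
  -- The wealth `x + (x / 2) X_T` equals `x / 2 + (x / 2) f` for `f = 1 + X_T`.
  refine ⟨2 / x * c, ?_⟩
  rintro f ⟨H, X, hX, rfl⟩
  have hadm : IsConstrainedAdmissible P F S H X := ⟨1, zero_le_one, hX⟩
  refine (measure_mono_ae ?_).trans (hc _ _ (hadm.const_mul (half_pos hx).le) ?_)
  · filter_upwards [hX.bound] with ω hω (h : 2 / x * c < |1 + X ⊤ ω|)
    rw [abs_of_nonneg (by linarith [hω ⊤]), div_mul_eq_mul_div, div_lt_iff₀ hx] at h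
    change c < x + x / 2 * X ⊤ ω
    linarith
  · filter_upwards [hX.bound] with ω hω
    nlinarith [hω ⊤]

lemma NAC.of_valueFunction_ne_top [IsFiniteMeasure P] (hU : IsStochasticUtility P F U)
    (hx : 0 < x) (hu : valueFunction P F S U x ≠ ⊤) : NAC P F S := by
  intro H X hX hX0
  have hzero : P {ω | 0 < X ⊤ ω} = 0 := by
    refine le_antisymm (le_of_forall_pos_le_add fun ε hε => ?_) zero_le
    rw [zero_add]
    obtain ⟨c, hc⟩ := exists_measure_lt_wealth_le hU hu hx hε
    -- These sets have probability at most `ε`, and they increase to `{X_T > 0}` as `n → ∞`.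
    have hlim : Tendsto (fun n : ℕ => P {ω | 0 < X ⊤ ω ∧ c < x + n * X ⊤ ω}) atTop
        (𝓝 (P (⋃ n : ℕ, {ω | 0 < X ⊤ ω ∧ c < x + n * X ⊤ ω}))) := by
      refine tendsto_measure_iUnion_atTop fun n m hnm ω hω => ⟨hω.1, hω.2.trans_le ?_⟩
      have h0 := hω.1.le
      gcongr
    refine (measure_mono fun ω (hω : 0 < X ⊤ ω) => ?_).trans
      (le_of_tendsto' hlim fun n => (measure_mono fun ω hω => hω.2).trans
        (hc _ _ (hX.const_mul n.cast_nonneg) ?_))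
    · obtain ⟨n, hn⟩ := exists_nat_gt ((c - x) / X ⊤ ω)
      rw [div_lt_iff₀ hω] at hn
      exact Set.mem_iUnion.2 ⟨n, hω, by linarith⟩
    · filter_upwards [hX0] with ω hω
      exact le_add_of_nonneg_right (mul_nonneg n.cast_nonneg hω)
  have hle : ∀ᵐ ω ∂P, ¬ 0 < X ⊤ ω := by simpa [ae_iff] using hzero
  filter_upwards [hX0, hle] with ω h0 h1 using le_antisymm (not_lt.1 h1) h0

lemma IsOptimal.isCMaximal {H : RealProcess T Ω} (hH : IsOptimal P F S U x H)
    (hU : IsStochasticUtility P F U) (hu_top : valueFunction P F S U x ≠ ⊤)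
    (hu_bot : valueFunction P F S U x ≠ ⊥) : IsCMaximal P F S H := by
  refine ⟨hH.1, fun X hX K Y hY hXY => ?_⟩
  have hopt := hH.2 X hX
  have hY_le : expectedUtility P U x Y ≤ expectedUtility P U x X :=
    hopt.symm ▸ le_iSup₂_of_le K Y (le_iSup_of_le hY le_rfl)
  have hfin : ∀ᵐ ω ∂P, (-extendUtility U ω (x + X ⊤ ω)).toENNReal < ∞ := by
    refine ae_lt_top (measurable_ereal_toENNReal.comp
      (hU.measurable_comp (hX.measurable_top.const_add x)).neg) fun h0 => hu_bot ?_
    rw [← hopt, expectedUtility, extendedExpectation, if_pos h0]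
  have hX_pos : ∀ᵐ ω ∂P, 0 < x + X ⊤ ω := by
    filter_upwards [hfin] with ω hω
    by_contra h
    simp [extendUtility, h] at hω
  have heq := ae_eq_of_extendedExpectation_le
    (hU.measurable_comp (hX.measurable_top.const_add x)).aemeasurable
    (hU.measurable_comp (hY.measurable_top.const_add x)).aemeasurable ?_ hY_le
    (fun h => hu_top (hopt.symm.trans h)) (fun h => hu_bot (hopt.symm.trans h))
  · filter_upwards [heq, hX_pos, hXY, hU.strictMono] with ω h1 h2 h3 h4
    have h5 : 0 < x + Y ⊤ ω := h2.trans_le (by gcongr)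
    rw [extendUtility_of_pos U ω h2, extendUtility_of_pos U ω h5, EReal.coe_eq_coe_iff] at h1
    exact (add_left_cancel (h4.injOn h2 h5 h1)).symm
  · filter_upwards [hX_pos, hXY, hU.strictMono] with ω h2 h3 h4
    have h5 : 0 < x + Y ⊤ ω := h2.trans_le (by gcongr)
    rw [extendUtility_of_pos U ω h2, extendUtility_of_pos U ω h5, EReal.coe_le_coe_iff]
    exact h4.monotoneOn h2 h5 (by gcongr)

end Utility

end ConstrainedMarket

theorem mainTheorem10 {Ω : Type*} [mΩ : MeasurableSpace Ω] (P : Measure Ω) [IsProbabilityMeasure P]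
    {T : ℝ≥0} (F : Filtration (TimeInterval T) mΩ) (hF : UsualHypotheses P F)
    (S : RealProcess T Ω) (hS : IsContinuousSemimartingale P F S)
    (hS_pos : ∀ᵐ ω ∂P, ∀ t, 0 < S t ω)
    (U : Ω → ℝ → ℝ) (hU : IsStochasticUtility P F U)
    (x : ℝ) (hx : 0 < x)
    (H : RealProcess T Ω) (hH : IsOptimal P F S U x H)
    (hu_top : valueFunction P F S U x ≠ ⊤) (hu_bot : valueFunction P F S U x ≠ ⊥) :
    IsCMaximal P F S H ∧ NFLVRC P F S :=
  ⟨hH.isCMaximal hU hu_top hu_bot, .of_valueFunction_ne_top hU hx hu_top,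
    .of_valueFunction_ne_top hU hx hu_top⟩
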